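/- Let $n\ge 1$, let $\{a_i\}_{i\in I}$ and $\{b_j\}_{j\in J}$ be finite families of nonzero homogeneous polynomials in $\mathbb{C}[x_1,\dots,x_n]$, and let $\nu_i,\rho_j\in\mathbb{C}$ with $\operatorname{Re}\nu_i\ge 0$, $\operatorname{Re}\rho_j\ge 0$ and $$\sum_{i}\nu_i\deg a_i=\sum_j\rho_j\deg b_j .$$ For each $i$ and $j$ fix branches $\log a_i$ and $\log b_j$ of the logarithm on the orthant $\mathbb{R}^n_{>0}$, and put $a_i(x)^{\nu_i}=e^{\nu_i\log a_i(x)}$, $b_j(x)^{\rho_j}=e^{\rho_j\log b_j(x)}$ (at a zero of $a_i$ the power is $0^{\nu_i}$, which is $1$ if $\nu_i=0$ and $0$ otherwise). Here a branch of $\log p$, for $p$ homogeneous of degree $d$, is a measurable function $L$ on $\mathbb{R}^n_{>0}$ such that $e^{L(x)}=p(x)$ and $L(tx)=L(x)+d\log t$ for all $t>0$ wherever $p(x)\neq0$, and such that either $\operatorname{Im}L$ is bounded (as for the principal branch, or any other branch obtained by cutting $\mathbb{C}$ along a ray from the origin), or $p$ has no zero on $\mathbb{R}^n_{>0}$ and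 $L$ is continuous there. Let $\mathbb{P}^{n-1}_{>0}=\{[x_1:\dots:x_n]\in\mathbb{P}^{n-1}(\mathbb{R}): x_k>0 \text{ for all } k\}$ and $$\Omega=\sum_{k=1}^n(-1)^{n-k}\frac{dx_1}{x_1}\wedge\dots\wedge\widehat{\frac{dx_k}{x_k}}\wedge\dots\wedge\frac{dx_n}{x_n}.$$ For $p=\sum_{\ell\in\operatorname{supp}(p)}c_\ell x^\ell$ let $\mathrm{NP}_p\subset\mathbb{R}^n$ be its Newton polytope, the convex hull of $\operatorname{supp}(p)$. For a nonempty face $F$ of $\mathrm{NP}_p$ (the set of maximizers on $\mathrm{NP}_p$ of a linear functional; $F=\mathrm{NP}_p$ is allowed) let $p_F=\sum_{\ell\in F\cap\operatorname{supp}(p)}c_\ell x^\ell$. The polynomial $p$ is completely non-vanishing on $\mathbb{P}^{n-1}_{>0}$ if no $p_F$ vanishes at any point of $\mathbb{P}^{n-1}_{>0}$. Define the weighted Minkowski sums $$\mathcal{A}=\sum_i(\operatorname{Re}\nu_i)\,\mathrm{NP}_{a_i},\qquad \mathcal{B}=\sum_j(\operatorname{Re}\rho_j)\,\mathrm{NP}_{b_j}.$$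 Theorem. The integral $$\int_{\mathbb{P}^{n-1}_{>0}}\frac{\prod_i a_i(x)^{\nu_i}}{\prod_j b_j(x)^{\rho_j}}\,\Omega$$ converges absolutely if (R1) $\mathcal{B}$ is $(n-1)$-dimensional; (R2) $\mathcal{A}$ is contained in the relative interior of $\mathcal{B}$; (R3) every $b_j$ is completely non-vanishing on $\mathbb{P}^{n-1}_{>0}$. -/

import Mathlib

open scoped Pointwise LinearAlgebra.Projectivization

noncomputable section

namespace ProjIntegral

/-! ### Polytopes and polynomials -/

/-- A (nonempty, if `P` is a nonempty polytope) face of `P`: the set of maximizers on `P` of a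
linear functional `v ↦ ⟨y, v⟩`. The choice `y = 0` gives the face `P` itself. -/
def IsFace {n : ℕ} (P F : Set (Fin n → ℝ)) : Prop :=
  ∃ y : Fin n → ℝ, F = {v | v ∈ P ∧ ∀ w ∈ P, y ⬝ᵥ w ≤ y ⬝ᵥ v}

/-- A multi-index, interpreted as a vector of `ℝⁿ`. -/
def expVec {n : ℕ} (l : Fin n →₀ ℕ) : Fin n → ℝ := fun k => (l k : ℝ)

/-- The Newton polytope of `p`. -/
def newtonPolytope {n : ℕ} (p : MvPolynomial (Fin n) ℂ) : Set (Fin n → ℝ) :=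
  convexHull ℝ (expVec '' (p.support : Set (Fin n →₀ ℕ)))

open Classical in
/-- The truncated polynomial `p_F`: the terms of `p` whose exponent vector lies in `F`. -/
def truncation {n : ℕ} (p : MvPolynomial (Fin n) ℂ) (F : Set (Fin n → ℝ)) :
    MvPolynomial (Fin n) ℂ :=
  ∑ l ∈ p.support.filter (fun l => expVec l ∈ F), MvPolynomial.monomial l (p.coeff l)

/-- The value of a complex polynomial at a real point. -/
def evalReal {n : ℕ} (p : MvPolynomial (Fin n) ℂ) (x : Fin n → ℝ) : ℂ :=
  MvPolynomial.eval (fun k => (x k : ℂ)) p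

/-- The open positive orthant of `ℝⁿ`. -/
def orthant (n : ℕ) : Set (Fin n → ℝ) := {x | ∀ k, 0 < x k}

/-- The positive part of real projective space: the points that have homogeneous coordinates
which are all positive. -/
def posProj (n : ℕ) : Set (ℙ ℝ (Fin n → ℝ)) :=
  {q | ∃ (x : Fin n → ℝ) (hx : x ≠ 0), (∀ k, 0 < x k) ∧ q = Projectivization.mk ℝ x hx}

/-- `p` is completely non-vanishing on the set `X` of projective points: no truncation of `p` to a
face of its Newton polytope vanishes at a point of `X`. -/
def CompletelyNonvanishingOn {n : ℕ} (p : MvPolynomial (Fin n) ℂ)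
    (X : Set (ℙ ℝ (Fin n → ℝ))) : Prop :=
  ∀ F : Set (Fin n → ℝ), IsFace (newtonPolytope p) F →
    ∀ (x : Fin n → ℝ) (hx : x ≠ 0), Projectivization.mk ℝ x hx ∈ X →
      evalReal (truncation p F) x ≠ 0

/-! ### Branches of complex powers -/

/-- `L` is a branch of `log p` on the positive orthant, where `p` is homogeneous of degree `d`.
It is measurable, it is a logarithm of `p x` at each `x` with `p x ≠ 0`, and it is compatible with
positive scaling, so that the powers `exp (s * L x)` are homogeneous of degree `s * d`. Moreover
its argument is bounded (as it is for the principal branch, or for any other cut of the plane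
along a ray), or `p` has no zero on the orthant and `L` is a continuous branch there. -/
structure IsLogBranch {n : ℕ} (p : MvPolynomial (Fin n) ℂ) (d : ℕ) (L : (Fin n → ℝ) → ℂ) :
    Prop where
  measurable : Measurable ((orthant n).domRestrict L)
  exp_eq : ∀ x ∈ orthant n, evalReal p x ≠ 0 → Complex.exp (L x) = evalReal p x
  smul_eq : ∀ x ∈ orthant n, evalReal p x ≠ 0 → ∀ t : ℝ, 0 < t →
    L (t • x) = L x + (d : ℂ) * (Real.log t : ℂ)
  tame : (∃ C : ℝ, ∀ x ∈ orthant n, |(L x).im| ≤ C) ∨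
    ((∀ x ∈ orthant n, evalReal p x ≠ 0) ∧ ContinuousOn L (orthant n))

open Classical in
/-- The power `p(x)^s` for the branch `L` of `log p`; at a zero of `p` it is `0 ^ s`. -/
def branchPow {n : ℕ} (p : MvPolynomial (Fin n) ℂ) (L : (Fin n → ℝ) → ℂ) (s : ℂ)
    (x : Fin n → ℝ) : ℂ :=
  if evalReal p x = 0 then (0 : ℂ) ^ s else Complex.exp (s * L x)

/-- The function `∏ a_i(x)^{ν_i} / ∏ b_j(x)^{ρ_j}` on the positive orthant. -/
def quotientFun {n : ℕ} {ι κ : Type*} [Fintype ι] [Fintype κ]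
    (a : ι → MvPolynomial (Fin n) ℂ) (La : ι → (Fin n → ℝ) → ℂ) (ν : ι → ℂ)
    (b : κ → MvPolynomial (Fin n) ℂ) (Lb : κ → (Fin n → ℝ) → ℂ) (ρ : κ → ℂ)
    (x : Fin n → ℝ) : ℂ :=
  (∏ i, branchPow (a i) (La i) (ν i) x) / ∏ j, branchPow (b j) (Lb j) (ρ j) x

/-! ### Integration over the positive projective simplex -/

/-- The homogeneous coordinates of a projective point that are normalized by `x_n = 1`
(all of them are positive if the point lies in `posProj`). -/
def affineRep {m : ℕ} (q : ℙ ℝ (Fin (m + 1) → ℝ)) : Fin (m + 1) → ℝ :=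
  (q.rep (Fin.last m))⁻¹ • q.rep

/-- The function on the positive projective simplex that is induced by a function on the positive
orthant which is homogeneous of degree `0`. -/
def descend {m : ℕ} (g : (Fin (m + 1) → ℝ) → ℂ) (q : ℙ ℝ (Fin (m + 1) → ℝ)) : ℂ :=
  g (affineRep q)

/-- The map `(v_1, …, v_n) ↦ (v_l / x_l)_{l ≠ k}`: the tuple of the `1`-forms `dx_l / x_l` at the
point `x`, with the `k`-th one left out. -/
def dlogOmit {m : ℕ} (x : Fin (m + 1) → ℝ) (k : Fin (m + 1)) :
    (Fin (m + 1) → ℝ) →ₗ[ℝ] (Fin m → ℝ) :=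
  LinearMap.pi fun l => (x (k.succAbove l))⁻¹ • LinearMap.proj (k.succAbove l)

/-- The value at `x` of the canonical form
`Ω = ∑_k (-1)^{n-k} dx_1/x_1 ∧ … ∧ (dx_k/x_k omitted) ∧ … ∧ dx_n/x_n`, where `n = m + 1` and the
index `k` runs from `0` to `m` here. -/
def canonicalForm {m : ℕ} (x : Fin (m + 1) → ℝ) : (Fin (m + 1) → ℝ) [⋀^Fin m]→ₗ[ℝ] ℝ :=
  ∑ k : Fin (m + 1), ((-1 : ℝ) ^ (m - (k : ℕ))) •
    (Matrix.detRowAlternating (n := Fin m) (R := ℝ)).compLinearMap (dlogOmit x k)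

/-- The parametrization `(x_1, …, x_{n-1}) ↦ (x_1, …, x_{n-1}, 1)`. -/
def affineLift {m : ℕ} (u : Fin m → ℝ) : Fin (m + 1) → ℝ := Fin.snoc u 1

theorem affineLift_ne_zero {m : ℕ} (u : Fin m → ℝ) : affineLift u ≠ 0 := fun h => by
  simpa [affineLift] using congrFun h (Fin.last m)

/-- The affine chart `(x_1, …, x_{n-1}) ↦ [x_1 : … : x_{n-1} : 1]`. -/
def affineChart {m : ℕ} (u : Fin m → ℝ) : ℙ ℝ (Fin (m + 1) → ℝ) :=
  Projectivization.mk ℝ (affineLift u) (affineLift_ne_zero u)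

/-- The density of the pull-back of `Ω` along the affine chart: its value on the tangent vectors
`∂/∂x_1, …, ∂/∂x_{n-1}`. -/
def chartDensity {m : ℕ} (u : Fin m → ℝ) : ℝ :=
  canonicalForm (affineLift u) fun i : Fin m => Pi.single i.castSucc 1

/-- The quotient σ-algebra on projective space. -/
instance instMeasurableSpaceProj (n : ℕ) : MeasurableSpace (ℙ ℝ (Fin n → ℝ)) :=
  inferInstanceAs (MeasurableSpace (Quotient (projectivizationSetoid ℝ (Fin n → ℝ))))

/-- The measure on projective space, carried by the positive projective simplex, that is given
there by the volume form `Ω`. -/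
def canonicalMeasure (m : ℕ) : MeasureTheory.Measure (ℙ ℝ (Fin (m + 1) → ℝ)) :=
  ((MeasureTheory.volume.restrict (orthant m)).withDensity
    fun u => ENNReal.ofReal |chartDensity u|).map affineChart

/-! ### Consistency of the definitions -/

/-- In the affine chart, `Ω` is `∏ dx_k / x_k`. -/
theorem chartDensity_eq {m : ℕ} (u : Fin m → ℝ) : chartDensity u = ∏ i, (u i)⁻¹ := by
  unfold chartDensity canonicalForm
  have hsum : ∀ (s : Finset (Fin (m + 1)))
      (f : Fin (m + 1) → (Fin (m + 1) → ℝ) [⋀^Fin m]→ₗ[ℝ] ℝ) (v : Fin m → Fin (m + 1) → ℝ),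
      (∑ k ∈ s, f k) v = ∑ k ∈ s, f k v := by
    intro s f v
    induction s using Finset.cons_induction with
    | empty => simp
    | cons k s hk ih => rw [Finset.sum_cons, Finset.sum_cons, AlternatingMap.add_apply, ih]
  rw [hsum, Finset.sum_eq_single (Fin.last m)]
  · simp only [AlternatingMap.smul_apply, AlternatingMap.compLinearMap_apply]
    have : (fun i : Fin m => dlogOmit (affineLift u) (Fin.last m)
        (Pi.single i.castSucc (1 : ℝ))) = Matrix.diagonal fun i => (u i)⁻¹ := by
      funext i l
      by_cases h : i = l
      · subst h; simp [dlogOmit, affineLift]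
      · have h2 : l ≠ i := fun e => h e.symm
        simp [dlogOmit, affineLift, Matrix.diagonal, h, h2]
    rw [this]
    have h3 := Matrix.det_diagonal (d := fun i => (u i)⁻¹)
    simpa [Matrix.det] using h3
  · intro k _ hk
    simp only [AlternatingMap.smul_apply, AlternatingMap.compLinearMap_apply]
    obtain ⟨l, hl⟩ := Fin.exists_castSucc_eq.2 hk
    have : Matrix.detRowAlternating (n := Fin m) (R := ℝ) (fun i : Fin m =>
        dlogOmit (affineLift u) k (Pi.single i.castSucc (1 : ℝ))) = 0 := by
      refine AlternatingMap.map_coord_zero _ l ?_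
      funext j
      have : k.succAbove j ≠ l.castSucc := hl ▸ Fin.succAbove_ne _ _
      simp [dlogOmit, this]
    rw [this, smul_zero]
  · simp

/-- The function induced by `g` on projective space does not depend on the choice of positive
homogeneous coordinates. -/
theorem descend_mk {m : ℕ} (g : (Fin (m + 1) → ℝ) → ℂ)
    (hg : ∀ x ∈ orthant (m + 1), ∀ t : ℝ, 0 < t → g (t • x) = g x)
    (x : Fin (m + 1) → ℝ) (hx : x ∈ orthant (m + 1)) (hx0 : x ≠ 0) :
    descend g (Projectivization.mk ℝ x hx0) = g x := by
  obtain ⟨c, hc⟩ := Projectivization.exists_smul_eq_mk_rep ℝ x hx0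
  have h0 : 0 < x (Fin.last m) := hx _
  have hc0 : (c : ℝ) ≠ 0 := c.ne_zero
  rw [descend, affineRep, ← hc, ← hg x hx _ (inv_pos.2 h0)]
  congr 1
  funext k
  simp only [Units.smul_def, Pi.smul_apply, smul_eq_mul]
  field_simp

theorem measurable_affineChart (m : ℕ) : Measurable (affineChart (m := m)) := by
  have h1 : Measurable fun u : Fin m → ℝ =>
      (⟨affineLift u, affineLift_ne_zero u⟩ : {v : Fin (m + 1) → ℝ // v ≠ 0}) := by
    refine Measurable.subtype_mk (measurable_pi_lambda _ fun k => ?_)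
    refine Fin.lastCases ?_ (fun i => ?_) k
    · simp [affineLift]
    · simpa [affineLift] using measurable_pi_apply i
  exact (measurable_quotient_mk'' (s := projectivizationSetoid ℝ (Fin (m + 1) → ℝ))).comp h1

theorem affineRep_affineChart {m : ℕ} (u : Fin m → ℝ) :
    affineRep (affineChart u) = affineLift u := by
  obtain ⟨c, hc⟩ := Projectivization.exists_smul_eq_mk_rep ℝ (affineLift u) (affineLift_ne_zero u)
  have hc0 : (c : ℝ) ≠ 0 := c.ne_zero
  have h1 : affineLift u (Fin.last m) = 1 := by simp [affineLift]
  rw [affineRep, affineChart, ← hc]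
  funext k
  simp only [Units.smul_def, Pi.smul_apply, smul_eq_mul, h1]
  field_simp

theorem measurableEmbedding_affineChart (m : ℕ) : MeasurableEmbedding (affineChart (m := m)) where
  injective u v h := by
    have := congrArg affineRep h
    rw [affineRep_affineChart, affineRep_affineChart] at this
    exact (Fin.snoc_injective2 this).1
  measurable := measurable_affineChart m
  measurableSet_image' {s} hs := by
    change MeasurableSet ((fun v : {v : Fin (m + 1) → ℝ // v ≠ 0} =>
      Projectivization.mk ℝ v.1 v.2) ⁻¹' (affineChart '' s))
    have : (fun v : {v : Fin (m + 1) → ℝ // v ≠ 0} =>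
        Projectivization.mk ℝ v.1 v.2) ⁻¹' (affineChart '' s) =
        {v | v.1 (Fin.last m) ≠ 0} ∩
          (fun v => fun i : Fin m => v.1 i.castSucc / v.1 (Fin.last m)) ⁻¹' s := by
      ext ⟨v, hv⟩
      simp only [Set.mem_preimage, Set.mem_image, Set.mem_inter_iff, Set.mem_ofPred_eq]
      constructor
      · rintro ⟨u, hu, h⟩
        obtain ⟨c, hc⟩ := (Projectivization.mk_eq_mk_iff ℝ _ _ (affineLift_ne_zero u) hv).1 h
        have hc0 : (c : ℝ) ≠ 0 := c.ne_zero
        have hl := congrFun hc (Fin.last m)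
        simp only [Units.smul_def, Pi.smul_apply, smul_eq_mul, affineLift, Fin.snoc_last] at hl
        have hv0 : v (Fin.last m) ≠ 0 := right_ne_zero_of_mul (hl ▸ one_ne_zero)
        refine ⟨hv0, ?_⟩
        convert hu using 1
        funext i
        have hi := congrFun hc i.castSucc
        simp only [Units.smul_def, Pi.smul_apply, smul_eq_mul, affineLift, Fin.snoc_castSucc] at hi
        rw [div_eq_iff hv0, ← hi]
        linear_combination (-v i.castSucc) * hl
      · rintro ⟨h0, h⟩
        refine ⟨_, h, (Projectivization.mk_eq_mk_iff' ℝ _ _ _ _).2 ⟨(v (Fin.last m))⁻¹, ?_⟩⟩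
        funext k
        refine Fin.lastCases ?_ (fun i => ?_) k
        · simp [affineLift, h0]
        · simp [affineLift, div_eq_inv_mul]
    rw [this]
    have hl : Measurable fun v : {v : Fin (m + 1) → ℝ // v ≠ 0} => v.1 (Fin.last m) :=
      (measurable_pi_apply _).comp measurable_subtype_coe
    exact (hl (MeasurableSet.singleton 0).compl).inter
      ((measurable_pi_lambda _ fun i =>
        ((measurable_pi_apply _).comp measurable_subtype_coe).div hl) hs)

/-- Integrability with respect to `Ω` over the positive projective simplex is integrability of the
integrand at `x_n = 1` with respect to `∏ dx_k / x_k` over the positive orthant. -/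
theorem integrableOn_descend_iff {m : ℕ} (g : (Fin (m + 1) → ℝ) → ℂ) :
    MeasureTheory.IntegrableOn (descend g) (posProj (m + 1)) (canonicalMeasure m) ↔
      MeasureTheory.IntegrableOn (fun u : Fin m → ℝ => (∏ i, (u i)⁻¹) • g (affineLift u))
        (orthant m) := by
  have hO : MeasurableSet (orthant m) := by
    have : orthant m = ⋂ k, {x | 0 < x k} := by ext; simp [orthant]
    rw [this]
    exact MeasurableSet.iInter fun k => measurableSet_lt measurable_const (measurable_pi_apply k)
  have hpos : ∀ u ∈ orthant m, affineChart u ∈ posProj (m + 1) := fun u hu =>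
    ⟨affineLift u, affineLift_ne_zero u, fun k => by
      refine Fin.lastCases ?_ (fun i => ?_) k
      · simp [affineLift]
      · simpa [affineLift] using hu i, rfl⟩
  have hd : Measurable fun u : Fin m → ℝ => ∏ i, (u i)⁻¹ :=
    Finset.measurable_prod _ fun i _ => (measurable_pi_apply i).inv
  have hD : Measurable fun u : Fin m → ℝ => ‖∏ i, (u i)⁻¹‖₊ := hd.nnnorm
  have hfun : (fun u : Fin m → ℝ => ENNReal.ofReal |chartDensity u|) =
      fun u => ((‖∏ i, (u i)⁻¹‖₊ : NNReal) : ENNReal) := by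
    funext u
    rw [chartDensity_eq, ← Real.norm_eq_abs, ofReal_norm]
    rfl
  rw [canonicalMeasure, (measurableEmbedding_affineChart m).integrableOn_map_iff, hfun,
    MeasureTheory.IntegrableOn, MeasureTheory.Measure.restrict_eq_self_of_ae_mem,
    MeasureTheory.integrable_withDensity_iff_integrable_smul hD, MeasureTheory.IntegrableOn]
  · refine MeasureTheory.integrable_congr ?_
    filter_upwards [MeasureTheory.ae_restrict_mem hO] with u hu
    have h0 : 0 ≤ ∏ i, (u i)⁻¹ := Finset.prod_nonneg fun i _ => (inv_pos.2 (hu i)).le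
    simp only [Function.comp, descend, affineRep_affineChart, NNReal.smul_def, coe_nnnorm,
      Real.norm_of_nonneg h0]
  · refine (MeasureTheory.withDensity_absolutelyContinuous _ _).ae_le ?_
    filter_upwards [MeasureTheory.ae_restrict_mem hO] with u hu using hpos u hu

theorem evalReal_smul {n : ℕ} {p : MvPolynomial (Fin n) ℂ} {d : ℕ} (hp : p.IsHomogeneous d)
    (t : ℝ) (x : Fin n → ℝ) : evalReal p (t • x) = (t : ℂ) ^ d * evalReal p x := by
  have : (fun k => (((t • x) k : ℝ) : ℂ)) = (t : ℂ) • fun k => (x k : ℂ) := by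
    funext k; simp
  rw [evalReal, this, evalReal, MvPolynomial.eval_eq, MvPolynomial.eval_eq, Finset.mul_sum]
  refine Finset.sum_congr rfl fun l hl => ?_
  have hl' : ∑ i ∈ l.support, l i = d := by
    have := hp (MvPolynomial.mem_support_iff.1 hl)
    simpa [Finsupp.weight_apply, Finsupp.sum] using this
  simp only [Pi.smul_apply, smul_eq_mul, mul_pow, Finset.prod_mul_distrib]
  rw [Finset.prod_pow_eq_pow_sum, hl']
  ring

/-- The branch of a power is homogeneous of degree `s * d`. -/
theorem branchPow_smul {n : ℕ} {p : MvPolynomial (Fin n) ℂ} {d : ℕ} (hp : p.IsHomogeneous d)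
    {L : (Fin n → ℝ) → ℂ} (hL : IsLogBranch p d L) (s : ℂ) {x : Fin n → ℝ} (hx : x ∈ orthant n)
    {t : ℝ} (ht : 0 < t) :
    branchPow p L s (t • x) = Complex.exp (s * d * (Real.log t : ℂ)) * branchPow p L s x := by
  have ht' : ((t : ℂ) ^ d) ≠ 0 := pow_ne_zero _ (by exact_mod_cast ht.ne')
  unfold branchPow
  by_cases h : evalReal p x = 0
  · rcases eq_or_ne s 0 with rfl | hs
    · simp [evalReal_smul hp, h]
    · simp [evalReal_smul hp, h, Complex.zero_cpow hs]
  · rw [if_neg h, if_neg (by rw [evalReal_smul hp]; exact mul_ne_zero ht' h),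
      hL.smul_eq x hx h t ht, ← Complex.exp_add]
    congr 1
    ring

/-- The integrand is homogeneous of degree `0`, and so it is a function on the positive
projective simplex. -/
theorem quotientFun_smul {n : ℕ} {ι κ : Type*} [Fintype ι] [Fintype κ]
    {a : ι → MvPolynomial (Fin n) ℂ} {b : κ → MvPolynomial (Fin n) ℂ} {da : ι → ℕ} {db : κ → ℕ}
    {ν : ι → ℂ} {ρ : κ → ℂ}
    (ha : ∀ i, (a i).IsHomogeneous (da i)) (hb : ∀ j, (b j).IsHomogeneous (db j))
    (hdeg : ∑ i, ν i * (da i : ℂ) = ∑ j, ρ j * (db j : ℂ))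
    {La : ι → (Fin n → ℝ) → ℂ} {Lb : κ → (Fin n → ℝ) → ℂ}
    (hLa : ∀ i, IsLogBranch (a i) (da i) (La i)) (hLb : ∀ j, IsLogBranch (b j) (db j) (Lb j))
    (x : Fin n → ℝ) (hx : x ∈ orthant n) (t : ℝ) (ht : 0 < t) :
    quotientFun a La ν b Lb ρ (t • x) = quotientFun a La ν b Lb ρ x := by
  unfold quotientFun
  simp only [fun i => branchPow_smul (ha i) (hLa i) (ν i) hx ht,
    fun j => branchPow_smul (hb j) (hLb j) (ρ j) hx ht, Finset.prod_mul_distrib,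
    ← Complex.exp_sum, ← Finset.sum_mul, hdeg]
  exact mul_div_mul_left _ _ (Complex.exp_ne_zero _)

/-- The principal branch of the logarithm is a branch in the sense above. -/
theorem isLogBranch_log {n : ℕ} {p : MvPolynomial (Fin n) ℂ} {d : ℕ} (hp : p.IsHomogeneous d) :
    IsLogBranch p d fun x => Complex.log (evalReal p x) where
  measurable := by
    have : Continuous fun x : Fin n → ℝ => evalReal p x :=
      (MvPolynomial.continuous_eval p).comp (by fun_prop)
    exact (Complex.measurable_log.comp this.measurable).comp measurable_subtype_coe
  exp_eq x _ h := Complex.exp_log h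
  smul_eq x _ h t ht := by
    rw [evalReal_smul hp, ← Complex.ofReal_pow, Complex.log_ofReal_mul (pow_pos ht d) h,
      Real.log_pow]
    push_cast
    ring
  tame := Or.inl ⟨Real.pi, fun x _ => by
    simpa [Complex.log_im] using Complex.abs_arg_le_pi _⟩

end ProjIntegral

end

namespace ProjIntegral

open Filter Topology MeasureTheory

/-! ### The argument of a continuous branch -/

/-! In logarithmic coordinates `x_k = exp ξ_k`, normalized by `ξ_n = 0`, the form Ω becomes Lebesgue
measure, so a bound of the integrand by `C * exp (-δ ∑ |ξ_k|)` suffices.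

Each `a_i` is at most a constant times its largest monomial. The numerator is therefore at most a
constant times `exp ⟨v, ξ⟩`, where `v ∈ A` depends on `ξ` but ranges over finitely many points.
Conversely, complete non-vanishing bounds `|b_j|` below by a constant times its largest monomial, so
the denominator is at least a constant times `exp ⟨v', ξ⟩` for every `v' ∈ B`. By (R1) and (R2), `v'
= v + w` is allowed for all small `w` with coordinate sum zero; choosing `w` with `⟨w, ξ⟩ = δ ∑
|ξ_k|` gives the decay (`exists_norm_quotientFun_le`).

The crux is the lower bound (`exists_truncation_eq_zero`). If it fails along a sequence, the ratios
of monomials to the dominating one converge on a subsequence; the monomials with nonzero limit span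
a face, and the limits are the values of these ratios at a positive point, where the truncation to
that face vanishes.

A complex exponent also brings in the argument of the branch, which is bounded because a polynomial
of given degree can turn only boundedly often along a segment. -/

/-- A product of linear factors without zeros on `[0, 1]` has a continuous logarithm there, and
its argument is bounded in terms of the number of factors. -/
theorem exists_continuousOn_log_prod (M : Multiset ℂ)
    (hM : ∀ α ∈ M, ∀ s ∈ Set.Icc (0 : ℝ) 1, (s : ℂ) ≠ α) :
    ∃ G : ℝ → ℂ, ContinuousOn G (Set.Icc 0 1) ∧
      (∀ s ∈ Set.Icc (0 : ℝ) 1, Complex.exp (G s) = (M.map fun α => (s : ℂ) - α).prod) ∧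
      ∀ s ∈ Set.Icc (0 : ℝ) 1, |(G s).im| ≤ M.card * (2 * Real.pi) := by
  induction M using Multiset.induction_on with
  | empty => exact ⟨fun _ => 0, continuousOn_const, by simp, by simp⟩
  | cons α M ih =>
    obtain ⟨G, hG, hexp, him⟩ := ih fun β hβ => hM β (Multiset.mem_cons_of_mem hβ)
    have hα := hM α (Multiset.mem_cons_self α M)
    have hα0 : α ≠ 0 := fun h => hα 0 (by simp) (by simp [h])
    -- Factor `s - α = -α * (1 - s / α)`. If `1 - s / α` were a real `r ≤ 0`, then `α = s / (1 - r)`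
    -- would lie in `[0, 1]`; so the principal logarithm is continuous on the second factor.
    have hslit : ∀ s ∈ Set.Icc (0 : ℝ) 1, 1 - (s : ℂ) / α ∈ Complex.slitPlane := by
      intro s hs
      rw [Complex.mem_slitPlane_iff_not_le_zero]
      intro hle
      obtain ⟨r, hr⟩ : ∃ r : ℝ, 1 - (s : ℂ) / α = r :=
        ⟨_, Complex.ext rfl (by simpa using (Complex.le_def.1 hle).2)⟩
      have hr0 : r ≤ 0 := by rw [hr] at hle; exact_mod_cast hle
      have h1 : (s : ℂ) = α * ((1 - r : ℝ) : ℂ) := by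
        push_cast; rw [← hr]; field_simp; ring
      have h2 : ((1 - r : ℝ) : ℂ) ≠ 0 := by
        exact_mod_cast (by linarith : (0 : ℝ) < 1 - r).ne'
      refine hα (s / (1 - r)) ⟨div_nonneg hs.1 (by linarith), ?_⟩ ?_
      · rw [div_le_one (by linarith)]; linarith [hs.2]
      · rw [Complex.ofReal_div, h1, mul_div_assoc, div_self h2, mul_one]
    refine ⟨fun s => (Complex.log (-α) + Complex.log (1 - (s : ℂ) / α)) + G s, ?_, ?_, ?_⟩
    · refine (continuousOn_const.add (ContinuousOn.clog ?_ hslit)).add hG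
      fun_prop
    · intro s hs
      rw [Complex.exp_add, Complex.exp_add, Complex.exp_log (neg_ne_zero.2 hα0),
        Complex.exp_log (Complex.slitPlane_ne_zero (hslit s hs)), hexp s hs, Multiset.map_cons,
        Multiset.prod_cons]
      congr 1
      field_simp
      ring
    · intro s hs
      have h1 := Complex.abs_arg_le_pi (-α)
      have h2 := Complex.abs_arg_le_pi (1 - (s : ℂ) / α)
      have h3 := him s hs
      simp only [Complex.add_im, Complex.log_im, Multiset.card_cons, Nat.cast_add, Nat.cast_one]
      have h4 := abs_add_three (-α).arg (1 - (s : ℂ) / α).arg (G s).im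
      linarith

/-- Two continuous logarithms of the same function on an interval differ by a constant. -/
theorem sub_eq_sub_of_exp_eq {f g : ℝ → ℂ} (hf : ContinuousOn f (Set.Icc 0 1))
    (hg : ContinuousOn g (Set.Icc 0 1))
    (h : ∀ s ∈ Set.Icc (0 : ℝ) 1, Complex.exp (f s) = Complex.exp (g s)) :
    f 1 - g 1 = f 0 - g 0 := by
  have hmem : ∀ s ∈ Set.Icc (0 : ℝ) 1, ∃ k : ℤ, f s - g s = k * (2 * Real.pi * Complex.I) := by
    intro s hs
    rw [← Complex.exp_eq_one_iff, Complex.exp_sub, h s hs, div_self (Complex.exp_ne_zero _)]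
  have hre : ∀ s ∈ Set.Icc (0 : ℝ) 1, (f s - g s).re = 0 := by
    intro s hs
    obtain ⟨k, hk⟩ := hmem s hs
    simp [hk]
  -- The difference is `2πi` times an integer, and a continuous integer-valued function on an
  -- interval is constant.
  have hdisc : DiscreteTopology (Set.range ((↑) : ℤ → ℝ)) :=
    Int.isClosedEmbedding_coe_real.isEmbedding.toHomeomorph.symm.isEmbedding.discreteTopology
  have hcont : ContinuousOn (fun s => (f s - g s).im / (2 * Real.pi)) (Set.Icc 0 1) :=
    (Complex.continuous_im.comp_continuousOn (hf.sub hg)).div_const _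
  have him := isPreconnected_Icc.constant_of_mapsTo (T := Set.range ((↑) : ℤ → ℝ))
    (isDiscrete_iff_discreteTopology.2 hdisc) hcont
    (fun s hs => by
      obtain ⟨k, hk⟩ := hmem s hs
      refine ⟨k, ?_⟩
      have := Real.pi_pos.ne'
      simp [hk]) (show (1 : ℝ) ∈ Set.Icc (0 : ℝ) 1 by simp)
    (show (0 : ℝ) ∈ Set.Icc (0 : ℝ) 1 by simp)
  refine Complex.ext ((hre 1 (by simp)).trans (hre 0 (by simp)).symm) ?_
  have := Real.pi_pos.ne'
  field_simp at him
  exact him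

/-- Up to a constant, `f` is a sum of logarithms of linear factors. Each has argument at most `2π`
in absolute value at both ends, hence `4π` per root; only the degree of `q` enters. -/
theorem abs_im_sub_le_of_exp_eq_eval {q : Polynomial ℂ} {f : ℝ → ℂ}
    (hf : ContinuousOn f (Set.Icc 0 1))
    (h : ∀ s ∈ Set.Icc (0 : ℝ) 1, Complex.exp (f s) = q.eval (s : ℂ)) :
    |(f 1).im - (f 0).im| ≤ q.natDegree * (4 * Real.pi) := by
  have hq : q ≠ 0 := by
    rintro rfl
    exact Complex.exp_ne_zero _ ((h 0 (by simp)).trans (by simp))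
  have hsplit := IsAlgClosed.splits q
  obtain ⟨G, hG, hexp, him⟩ := exists_continuousOn_log_prod q.roots fun α hα s hs hsα => by
    refine Complex.exp_ne_zero (f s) ?_
    rw [h s hs, hsα]
    exact (Polynomial.mem_roots hq).1 hα
  have key := sub_eq_sub_of_exp_eq hf
    (g := fun s => Complex.log q.leadingCoeff + G s) (continuousOn_const.add hG)
    (fun s hs => by
      rw [Complex.exp_add, Complex.exp_log (Polynomial.leadingCoeff_ne_zero.2 hq), hexp s hs,
        h s hs, hsplit.eval_eq_prod_roots])
  have key' := congrArg Complex.im key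
  simp only [Complex.sub_im, Complex.add_im] at key'
  have h0 := abs_le.1 (him 0 (by simp))
  have h1 := abs_le.1 (him 1 (by simp))
  have hc : (q.roots.card : ℝ) * (2 * Real.pi) ≤ q.natDegree * (2 * Real.pi) := by
    have : (q.roots.card : ℝ) ≤ q.natDegree := by exact_mod_cast q.card_roots'
    have := Real.pi_pos
    gcongr
  rw [abs_le]
  constructor <;> linarith [h0.1, h0.2, h1.1, h1.2]

theorem natDegree_aeval_le {n : ℕ} (p : MvPolynomial (Fin n) ℂ) (g : Fin n → Polynomial ℂ)
    (hg : ∀ k, (g k).natDegree ≤ 1) :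
    (MvPolynomial.aeval g p).natDegree ≤ p.totalDegree := by
  rw [MvPolynomial.aeval_def, MvPolynomial.eval₂_eq]
  refine Polynomial.natDegree_sum_le_of_forall_le _ _ fun l hl => ?_
  refine (Polynomial.natDegree_C_mul_le _ _).trans ?_
  refine (Polynomial.natDegree_prod_le _ _).trans ?_
  refine le_trans (Finset.sum_le_sum fun i _ => ?_) (MvPolynomial.le_totalDegree hl)
  exact (Polynomial.natDegree_pow_le_of_le _ (hg i)).trans (by simp)

/-- Every branch of the logarithm has bounded argument: along a segment a polynomial is a product
of linear factors, each of which turns by at most a bounded angle. -/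
theorem IsLogBranch.exists_abs_im_le {n : ℕ} {p : MvPolynomial (Fin n) ℂ} {d : ℕ}
    {L : (Fin n → ℝ) → ℂ} (hL : IsLogBranch p d L) :
    ∃ C : ℝ, ∀ x ∈ orthant n, |(L x).im| ≤ C := by
  rcases hL.tame with h | ⟨hp, hc⟩
  · exact h
  refine ⟨|(L 1).im| + p.totalDegree * (4 * Real.pi), fun x hx => ?_⟩
  -- The restriction of `p` to the segment from `(1, …, 1)` to `x`; its degree is bounded
  -- independently of `x`.
  set q : Polynomial ℂ := MvPolynomial.aeval
    (fun k => Polynomial.C 1 + Polynomial.C ((x k : ℂ) - 1) * Polynomial.X) p with hq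
  have hqd : q.natDegree ≤ p.totalDegree := natDegree_aeval_le p _ fun k => by compute_degree
  have hmem : ∀ s ∈ Set.Icc (0 : ℝ) 1, (1 + s • (x - 1) : Fin n → ℝ) ∈ orthant n := by
    intro s hs k
    have h1 : (1 + s • (x - 1) : Fin n → ℝ) k = (1 - s) + s * x k := by simp; ring
    rw [h1]
    rcases hs.2.eq_or_lt with rfl | h
    · simpa using hx k
    · have := mul_nonneg hs.1 (hx k).le
      linarith
  have heval : ∀ s : ℝ, q.eval (s : ℂ) = evalReal p (1 + s • (x - 1)) := by
    intro s
    rw [hq, ← Polynomial.coe_evalRingHom, MvPolynomial.aeval_def, MvPolynomial.hom_eval₂,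
      evalReal, MvPolynomial.eval, MvPolynomial.coe_eval₂Hom]
    congr 1
    · ext z; simp
    · funext k
      simp
      ring
  have key := abs_im_sub_le_of_exp_eq_eval (q := q) (f := fun s => L (1 + s • (x - 1)))
    (hc.comp (by fun_prop) hmem)
    (fun s hs => by rw [heval, hL.exp_eq _ (hmem s hs) (hp _ (hmem s hs))])
  simp only [one_smul, zero_smul, add_sub_cancel, add_zero] at key
  have h1 : (q.natDegree : ℝ) * (4 * Real.pi) ≤ p.totalDegree * (4 * Real.pi) := by
    have : (q.natDegree : ℝ) ≤ p.totalDegree := by exact_mod_cast hqd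
    have := Real.pi_pos
    gcongr
  have h2 := abs_add_le ((L x).im - (L 1).im) (L 1).im
  rw [sub_add_cancel] at h2
  linarith

/-! ### Bounds for the powers -/

/-- Isolates the effect of a complex exponent: a factor that a bounded argument keeps between two
positive constants. -/
theorem IsLogBranch.norm_exp_mul {n : ℕ} {p : MvPolynomial (Fin n) ℂ} {d : ℕ}
    {L : (Fin n → ℝ) → ℂ} (hL : IsLogBranch p d L) (s : ℂ) {x : Fin n → ℝ} (hx : x ∈ orthant n)
    (h : evalReal p x ≠ 0) :
    ‖Complex.exp (s * L x)‖ = Real.exp (-(s.im * (L x).im)) * ‖evalReal p x‖ ^ s.re := by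
  have hn : ‖evalReal p x‖ = Real.exp (L x).re := by
    rw [← hL.exp_eq x hx h, Complex.norm_exp]
  rw [Complex.norm_exp, hn, ← Real.exp_mul, ← Real.exp_add, Complex.mul_re]
  congr 1
  ring

theorem IsLogBranch.exists_norm_branchPow_le {n : ℕ} {p : MvPolynomial (Fin n) ℂ} {d : ℕ}
    {L : (Fin n → ℝ) → ℂ} (hL : IsLogBranch p d L) (s : ℂ) :
    ∃ C : ℝ, 0 < C ∧ ∀ x ∈ orthant n, ‖branchPow p L s x‖ ≤ C * ‖evalReal p x‖ ^ s.re := by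
  obtain ⟨C, hC⟩ := hL.exists_abs_im_le
  refine ⟨Real.exp (|s.im| * |C|), Real.exp_pos _, fun x hx => ?_⟩
  unfold branchPow
  split_ifs with h
  · rcases eq_or_ne s 0 with rfl | hs
    · simp
    · rw [Complex.zero_cpow hs, norm_zero]
      positivity
  · rw [hL.norm_exp_mul s hx h]
    have h1 : |s.im * (L x).im| ≤ |s.im| * |C| := by
      rw [abs_mul]
      exact mul_le_mul_of_nonneg_left ((hC x hx).trans (le_abs_self C)) (abs_nonneg _)
    have h2 : -(s.im * (L x).im) ≤ |s.im| * |C| := (neg_le_abs _).trans h1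
    gcongr

/-- Zeros of `p` must be excluded: for `s ≠ 0` with `s.re = 0` the power is `0` there, while `0 ^
s.re = 1`. -/
theorem IsLogBranch.exists_le_norm_branchPow {n : ℕ} {p : MvPolynomial (Fin n) ℂ} {d : ℕ}
    {L : (Fin n → ℝ) → ℂ} (hL : IsLogBranch p d L) (s : ℂ) :
    ∃ c : ℝ, 0 < c ∧ ∀ x ∈ orthant n, evalReal p x ≠ 0 →
      c * ‖evalReal p x‖ ^ s.re ≤ ‖branchPow p L s x‖ := by
  obtain ⟨C, hC⟩ := hL.exists_abs_im_le
  refine ⟨Real.exp (-(|s.im| * |C|)), Real.exp_pos _, fun x hx h => ?_⟩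
  unfold branchPow
  rw [if_neg h, hL.norm_exp_mul s hx h]
  have h1 : |s.im * (L x).im| ≤ |s.im| * |C| := by
    rw [abs_mul]
    exact mul_le_mul_of_nonneg_left ((hC x hx).trans (le_abs_self C)) (abs_nonneg _)
  have h2 : s.im * (L x).im ≤ |s.im| * |C| := (le_abs_self _).trans h1
  gcongr

/-! ### Polynomials in logarithmic coordinates -/

/-- The point of the orthant with logarithmic coordinates `ξ`. -/
noncomputable def expPoint {n : ℕ} (ξ : Fin n → ℝ) : Fin n → ℝ := fun k => Real.exp (ξ k)

theorem expPoint_mem_orthant {n : ℕ} (ξ : Fin n → ℝ) : expPoint ξ ∈ orthant n :=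
  fun _ => Real.exp_pos _

theorem prod_expPoint_pow {n : ℕ} (l : Fin n →₀ ℕ) (ξ : Fin n → ℝ) :
    ∏ k, expPoint ξ k ^ l k = Real.exp (expVec l ⬝ᵥ ξ) := by
  rw [dotProduct, Real.exp_sum]
  exact Finset.prod_congr rfl fun k _ => (Real.exp_nat_mul _ _).symm

theorem evalReal_expPoint {n : ℕ} (p : MvPolynomial (Fin n) ℂ) (ξ : Fin n → ℝ) :
    evalReal p (expPoint ξ) =
      ∑ l ∈ p.support, p.coeff l * (Real.exp (expVec l ⬝ᵥ ξ) : ℂ) := by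
  rw [evalReal, MvPolynomial.eval_eq']
  refine Finset.sum_congr rfl fun l _ => ?_
  rw [← prod_expPoint_pow]
  push_cast
  rfl

open Classical in
theorem evalReal_truncation_expPoint {n : ℕ} (p : MvPolynomial (Fin n) ℂ)
    (F : Set (Fin n → ℝ)) (ξ : Fin n → ℝ) :
    evalReal (truncation p F) (expPoint ξ) =
      ∑ l ∈ p.support with expVec l ∈ F, p.coeff l * (Real.exp (expVec l ⬝ᵥ ξ) : ℂ) := by
  rw [evalReal, truncation, map_sum]
  refine Finset.sum_congr rfl fun l _ => ?_
  rw [MvPolynomial.eval_monomial, Finsupp.prod_fintype _ _ (fun i => pow_zero _),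
    ← prod_expPoint_pow]
  push_cast
  rfl

theorem expVec_mem_newtonPolytope {n : ℕ} {p : MvPolynomial (Fin n) ℂ} {l : Fin n →₀ ℕ}
    (hl : l ∈ p.support) : expVec l ∈ newtonPolytope p :=
  subset_convexHull ℝ _ ⟨l, hl, rfl⟩

/-- A linear inequality on the support extends to the Newton polytope. -/
theorem dotProduct_le_of_mem_newtonPolytope {n : ℕ} {p : MvPolynomial (Fin n) ℂ}
    {y : Fin n → ℝ} {r : ℝ} (h : ∀ l ∈ p.support, expVec l ⬝ᵥ y ≤ r) {v : Fin n → ℝ}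
    (hv : v ∈ newtonPolytope p) : v ⬝ᵥ y ≤ r := by
  have hconv : Convex ℝ {v : Fin n → ℝ | v ⬝ᵥ y ≤ r} :=
    convex_halfSpace_le ⟨fun _ _ => add_dotProduct _ _ _, fun _ _ => smul_dotProduct _ _ _⟩ r
  refine convexHull_min ?_ hconv hv
  rintro _ ⟨l, hl, rfl⟩
  exact h l hl

/-- Triangle inequality against the largest monomial at `ξ`. Taking `l` in the support leaves only
finitely many possibilities as `ξ` varies. -/
theorem exists_norm_evalReal_le {n : ℕ} {p : MvPolynomial (Fin n) ℂ} (hp : p ≠ 0) :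
    ∃ C : ℝ, 0 < C ∧ ∀ ξ : Fin n → ℝ, ∃ l ∈ p.support,
      ‖evalReal p (expPoint ξ)‖ ≤ C * Real.exp (expVec l ⬝ᵥ ξ) := by
  have hne := MvPolynomial.support_nonempty.2 hp
  refine ⟨∑ l ∈ p.support, ‖p.coeff l‖,
    Finset.sum_pos (fun l hl => norm_pos_iff.2 (MvPolynomial.mem_support_iff.1 hl)) hne,
    fun ξ => ?_⟩
  obtain ⟨l, hl, hmax⟩ := p.support.exists_max_image (fun l => expVec l ⬝ᵥ ξ) hne
  refine ⟨l, hl, ?_⟩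
  rw [evalReal_expPoint, Finset.sum_mul]
  refine (norm_sum_le _ _).trans (Finset.sum_le_sum fun k hk => ?_)
  rw [norm_mul, Complex.norm_real, Real.norm_of_nonneg (Real.exp_pos _).le]
  gcongr
  exact hmax k hk

/-! ### Lower bounds from complete non-vanishing -/

/-- If the normalized values of `p` tend to zero along a sequence on which the monomial `l₀`
dominates, then a truncation of `p` vanishes at a positive point. -/
theorem exists_truncation_eq_zero {n : ℕ} {p : MvPolynomial (Fin n) ℂ} {l₀ : Fin n →₀ ℕ}
    (hl₀ : l₀ ∈ p.support) (ξ : ℕ → Fin n → ℝ)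
    (hξ : ∀ k, ∀ l ∈ p.support, expVec l ⬝ᵥ ξ k ≤ expVec l₀ ⬝ᵥ ξ k)
    (hlim : Tendsto (fun k => ∑ l ∈ p.support,
      p.coeff l * (Real.exp ((expVec l - expVec l₀) ⬝ᵥ ξ k) : ℂ)) atTop (𝓝 0)) :
    ∃ F, IsFace (newtonPolytope p) F ∧
      ∃ η : Fin n → ℝ, evalReal (truncation p F) (expPoint η) = 0 := by
  classical
  -- Dominance of `l₀` puts all ratios of monomials in `[0, 1]`, so a subsequence converges. The
  -- exponents with `w l ≠ 0` will be those on the face.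
  obtain ⟨w, hw, φ, hφ, hwlim⟩ := (isCompact_univ_pi
    (s := fun _ : p.support => Set.Icc (0 : ℝ) 1) fun _ => isCompact_Icc).tendsto_subseq
    (x := fun k l => Real.exp ((expVec l.1 - expVec l₀) ⬝ᵥ ξ k))
    (fun k l _ => ⟨(Real.exp_pos _).le, Real.exp_le_one_iff.2 (by
      rw [sub_dotProduct]; linarith [hξ k l.1 l.2])⟩)
  have hwl : ∀ l : p.support,
      Tendsto (fun k => Real.exp ((expVec l.1 - expVec l₀) ⬝ᵥ ξ (φ k))) atTop (𝓝 (w l)) :=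
    fun l => (tendsto_pi_nhds.1 hwlim) l
  have hsum : ∑ l : p.support, p.coeff l.1 * (w l : ℂ) = 0 := by
    refine tendsto_nhds_unique (tendsto_finsetSum _ fun l _ => ((Complex.continuous_ofReal.tendsto
      _).comp (hwl l)).const_mul (p.coeff l.1)) ?_
    refine (hlim.comp hφ.tendsto_atTop).congr fun k => ?_
    exact (Finset.sum_coe_sort p.support fun l =>
      p.coeff l * (Real.exp ((expVec l - expVec l₀) ⬝ᵥ ξ (φ k)) : ℂ)).symm
  -- `T` pairs with the surviving exponent differences. Its range is closed, so the limit of `T (ξ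
  -- (φ k))` is attained at some `η`, which gives `w l = exp ⟨l - l₀, η⟩`.
  let T : (Fin n → ℝ) →ₗ[ℝ] ({l : p.support // w l ≠ 0} → ℝ) :=
    LinearMap.pi fun l => dotProductBilin ℝ ℝ (expVec l.1.1 - expVec l₀)
  have hT : ∀ x l, T x l = (expVec l.1.1 - expVec l₀) ⬝ᵥ x := fun _ _ => rfl
  have hTlim : Tendsto (fun k => T (ξ (φ k))) atTop (𝓝 fun l => Real.log (w l.1)) := by
    rw [tendsto_pi_nhds]
    intro l
    refine ((Real.continuousAt_log l.2).tendsto.comp (hwl l.1)).congr fun k => ?_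
    simp [hT]
  have hrange : (fun l => Real.log (w l.1)) ∈ LinearMap.range T :=
    (Submodule.closed_of_finiteDimensional (LinearMap.range T)).mem_of_tendsto hTlim
      (Eventually.of_forall fun k => ⟨_, rfl⟩)
  obtain ⟨η, hη⟩ := hrange
  -- Subtracting a linear lift `g` of `T ξ` moves `ξ` into the kernel of `T`, where all surviving
  -- exponents tie with `l₀`. The correction converges, so it cannot offset the pairings that tend
  -- to `-∞`; one late term thus gives a functional `y` that selects exactly the surviving
  -- exponents.
  obtain ⟨g, hg⟩ := T.rangeRestrict.exists_rightInverse_of_surjective T.range_rangeRestrict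
  have hg' : ∀ x, T (g (T.rangeRestrict x)) = T x := fun x =>
    congrArg Subtype.val (LinearMap.congr_fun hg (T.rangeRestrict x))
  have hgc : Continuous g := g.continuous_of_finiteDimensional
  have hRlim : Tendsto (fun k => T.rangeRestrict (ξ (φ k))) atTop (𝓝 (T.rangeRestrict η)) := by
    rw [tendsto_subtype_rng]
    simpa [hη] using hTlim
  have hglim : Tendsto (fun k => g (T.rangeRestrict (ξ (φ k)))) atTop
      (𝓝 (g (T.rangeRestrict η))) := (hgc.tendsto _).comp hRlim
  have hneg : ∀ᶠ k in atTop, ∀ l : p.support, w l = 0 →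
      (expVec l.1 - expVec l₀) ⬝ᵥ (ξ (φ k) - g (T.rangeRestrict (ξ (φ k)))) < 0 := by
    rw [eventually_all]
    intro l
    by_cases hl : w l = 0
    swap
    · exact Eventually.of_forall fun k h => absurd h hl
    have hcd : Continuous fun x : Fin n → ℝ => Real.exp (-((expVec l.1 - expVec l₀) ⬝ᵥ x)) := by
      unfold dotProduct
      fun_prop
    have h1 := (hwl l).mul ((hcd.tendsto _).comp hglim)
    rw [hl, zero_mul] at h1
    filter_upwards [h1.eventually_lt_const one_pos] with k hk _
    rw [Function.comp_apply, ← Real.exp_add, Real.exp_lt_one_iff] at hk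
    rw [dotProduct_sub]
    linarith
  obtain ⟨k, hk⟩ := hneg.exists
  set y := ξ (φ k) - g (T.rangeRestrict (ξ (φ k))) with hy
  have hTy : T y = 0 := by rw [hy, map_sub, hg', sub_self]
  have hyeq : ∀ l : p.support, w l ≠ 0 → expVec l.1 ⬝ᵥ y = expVec l₀ ⬝ᵥ y := by
    intro l hl
    have := congrFun hTy ⟨l, hl⟩
    rw [hT, sub_dotProduct] at this
    exact sub_eq_zero.1 this
  have hylt : ∀ l : p.support, w l = 0 → expVec l.1 ⬝ᵥ y < expVec l₀ ⬝ᵥ y := by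
    intro l hl
    have := hk l hl
    rw [sub_dotProduct] at this
    linarith
  have hyle : ∀ v ∈ newtonPolytope p, v ⬝ᵥ y ≤ expVec l₀ ⬝ᵥ y := by
    intro v hv
    refine dotProduct_le_of_mem_newtonPolytope (fun l hl => ?_) hv
    by_cases h : w ⟨l, hl⟩ = 0
    · exact (hylt ⟨l, hl⟩ h).le
    · exact (hyeq ⟨l, hl⟩ h).le
  refine ⟨_, ⟨y, rfl⟩, η, ?_⟩
  rw [evalReal_truncation_expPoint]
  have hmem : ∀ l : p.support, expVec l.1 ∈ {v | v ∈ newtonPolytope p ∧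
      ∀ u ∈ newtonPolytope p, y ⬝ᵥ u ≤ y ⬝ᵥ v} ↔ w l ≠ 0 := by
    intro l
    simp only [Set.mem_ofPred_eq, dotProduct_comm y]
    constructor
    · rintro ⟨-, h⟩ h0
      exact absurd (h _ (expVec_mem_newtonPolytope hl₀)) (not_le.2 (hylt l h0))
    · intro h
      refine ⟨expVec_mem_newtonPolytope l.2, fun u hu => ?_⟩
      rw [hyeq l h]
      exact hyle u hu
  rw [Finset.sum_filter, ← Finset.sum_coe_sort p.support]
  trans ∑ l : p.support, (Real.exp (expVec l₀ ⬝ᵥ η) : ℂ) * (p.coeff l.1 * (w l : ℂ))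
  swap
  · rw [← Finset.mul_sum, hsum, mul_zero]
  refine Finset.sum_congr rfl fun l _ => ?_
  by_cases h : w l = 0
  · rw [if_neg (by rw [hmem l]; simpa using h), h]
    simp
  · rw [if_pos ((hmem l).2 h)]
    have h0 : 0 < w l := lt_of_le_of_ne (hw l trivial).1 (Ne.symm h)
    have h1 := congrFun hη ⟨l, h⟩
    rw [hT, sub_dotProduct] at h1
    have h2 : Real.exp (expVec l.1 ⬝ᵥ η) = Real.exp (expVec l₀ ⬝ᵥ η) * w l := by
      conv_rhs => rw [← Real.exp_log h0]
      rw [← Real.exp_add]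
      congr 1
      linarith
    rw [h2]
    push_cast
    ring

theorem CompletelyNonvanishingOn.evalReal_truncation_ne_zero {n : ℕ}
    {p : MvPolynomial (Fin (n + 1)) ℂ} (hp : CompletelyNonvanishingOn p (posProj (n + 1)))
    {F : Set (Fin (n + 1) → ℝ)} (hF : IsFace (newtonPolytope p) F) (ξ : Fin (n + 1) → ℝ) :
    evalReal (truncation p F) (expPoint ξ) ≠ 0 := by
  have h0 : expPoint ξ ≠ 0 := fun h =>
    (expPoint_mem_orthant ξ (Fin.last n)).ne' (congrFun h (Fin.last n))
  exact hp F hF _ h0 ⟨_, h0, expPoint_mem_orthant ξ, rfl⟩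

/-- Every truncation of the zero polynomial is an empty sum, and the functional `0` always defines a
face. -/
theorem CompletelyNonvanishingOn.ne_zero {n : ℕ}
    {p : MvPolynomial (Fin (n + 1)) ℂ} (hp : CompletelyNonvanishingOn p (posProj (n + 1))) :
    p ≠ 0 := by
  rintro rfl
  refine hp.evalReal_truncation_ne_zero ⟨0, rfl⟩ 0 ?_
  rw [evalReal_truncation_expPoint]
  simp

/-- A completely non-vanishing polynomial is bounded below by its dominating monomial. -/
theorem CompletelyNonvanishingOn.exists_le_norm_evalReal {n : ℕ}
    {p : MvPolynomial (Fin (n + 1)) ℂ} (hp : CompletelyNonvanishingOn p (posProj (n + 1))) :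
    ∃ c : ℝ, 0 < c ∧ ∀ ξ : Fin (n + 1) → ℝ, ∀ v ∈ newtonPolytope p,
      c * Real.exp (v ⬝ᵥ ξ) ≤ ‖evalReal p (expPoint ξ)‖ := by
  have hne := MvPolynomial.support_nonempty.2 hp.ne_zero
  -- The constant is found separately for each dominating monomial; the minimum of these finitely
  -- many constants then serves everywhere.
  have key : ∀ l₀ : p.support, ∃ c : ℝ, 0 < c ∧ ∀ ξ : Fin (n + 1) → ℝ,
      (∀ l ∈ p.support, expVec l ⬝ᵥ ξ ≤ expVec l₀.1 ⬝ᵥ ξ) →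
        c * Real.exp (expVec l₀.1 ⬝ᵥ ξ) ≤ ‖evalReal p (expPoint ξ)‖ := by
    rintro ⟨l₀, hl₀⟩
    by_contra! hcon
    choose ξ hξ hlt using fun k : ℕ => hcon (1 / ((k : ℝ) + 1)) (by positivity)
    obtain ⟨F, hF, η, hη⟩ := exists_truncation_eq_zero hl₀ ξ hξ (by
      refine squeeze_zero_norm (fun k => ?_) tendsto_one_div_add_atTop_nhds_zero_nat
      have h1 : ∑ l ∈ p.support,
          p.coeff l * (Real.exp ((expVec l - expVec l₀) ⬝ᵥ ξ k) : ℂ) =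
          (Real.exp (-(expVec l₀ ⬝ᵥ ξ k)) : ℂ) * evalReal p (expPoint (ξ k)) := by
        rw [evalReal_expPoint, Finset.mul_sum]
        refine Finset.sum_congr rfl fun l _ => ?_
        rw [sub_dotProduct, sub_eq_neg_add, Real.exp_add]
        push_cast
        ring
      rw [h1, norm_mul, Complex.norm_real, Real.norm_of_nonneg (Real.exp_pos _).le, Real.exp_neg,
        inv_mul_le_iff₀ (Real.exp_pos _), mul_comm]
      exact (hlt k).le)
    exact hp.evalReal_truncation_ne_zero hF η hη
  choose c hc hle using key
  have : Nonempty p.support := hne.to_subtype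
  obtain ⟨l₁, hl₁⟩ := Finite.exists_min c
  refine ⟨c l₁, hc l₁, fun ξ v hv => ?_⟩
  obtain ⟨l, hl, hmax⟩ := p.support.exists_max_image (fun l => expVec l ⬝ᵥ ξ) hne
  refine le_trans ?_ (hle ⟨l, hl⟩ ξ hmax)
  have h1 := hl₁ ⟨l, hl⟩
  have h2 := dotProduct_le_of_mem_newtonPolytope hmax hv
  have h3 := (hc ⟨l, hl⟩).le
  gcongr

theorem CompletelyNonvanishingOn.evalReal_ne_zero {n : ℕ}
    {p : MvPolynomial (Fin (n + 1)) ℂ} (hp : CompletelyNonvanishingOn p (posProj (n + 1)))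
    (ξ : Fin (n + 1) → ℝ) : evalReal p (expPoint ξ) ≠ 0 := by
  obtain ⟨c, hc, h⟩ := hp.exists_le_norm_evalReal
  obtain ⟨l, hl⟩ := MvPolynomial.support_nonempty.2 hp.ne_zero
  exact norm_pos_iff.1
    ((mul_pos hc (Real.exp_pos _)).trans_le (h ξ _ (expVec_mem_newtonPolytope hl)))

/-! ### The Minkowski sums -/

/-- The coordinate sum is fixed on the support, and the functionals `1` and `-1` carry this to the
convex hull. -/
theorem sum_eq_of_mem_newtonPolytope {n : ℕ} {p : MvPolynomial (Fin n) ℂ} {d : ℕ}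
    (hp : p.IsHomogeneous d) {v : Fin n → ℝ} (hv : v ∈ newtonPolytope p) :
    ∑ k, v k = d := by
  have hl : ∀ l ∈ p.support, ∑ k, expVec l k = d := by
    intro l hl
    have h1 := hp (MvPolynomial.mem_support_iff.1 hl)
    rw [show (1 : Fin n → ℕ) = fun _ => 1 from rfl, ← Finsupp.degree_eq_weight_one,
      Finsupp.degree_eq_sum] at h1
    simp only [expVec]
    exact_mod_cast h1
  have h1 := dotProduct_le_of_mem_newtonPolytope (y := 1) (r := d)
    (fun l h => by rw [dotProduct_one, hl l h]) hv
  have h2 := dotProduct_le_of_mem_newtonPolytope (y := -1) (r := -d)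
    (fun l h => by rw [dotProduct_neg, dotProduct_one, hl l h]) hv
  rw [dotProduct_one] at h1
  rw [dotProduct_neg, dotProduct_one] at h2
  linarith

/-- A subset of codimension one of a hyperplane `∑ v_k = D` contains a neighbourhood, within the
hyperplane, of each point of its relative interior. -/
theorem exists_add_mem_of_mem_intrinsicInterior {m : ℕ} {S : Set (Fin (m + 1) → ℝ)} {D : ℝ}
    (hS : ∀ v ∈ S, ∑ k, v k = D) (hdim : Module.finrank ℝ (affineSpan ℝ S).direction = m)
    {P : Fin (m + 1) → ℝ} (hP : P ∈ intrinsicInterior ℝ S) :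
    ∃ δ : ℝ, 0 < δ ∧ ∀ w : Fin (m + 1) → ℝ, ∑ k, w k = 0 → ‖w‖ ≤ δ → P + w ∈ S := by
  set f : (Fin (m + 1) → ℝ) →ₗ[ℝ] ℝ := ∑ k, LinearMap.proj k with hf
  have hfv : ∀ v, f v = ∑ k, v k := fun v => by simp [hf]
  have hle : (affineSpan ℝ S).direction ≤ LinearMap.ker f := by
    rw [direction_affineSpan, vectorSpan_def, Submodule.span_le]
    rintro _ ⟨v, hv, w, hw, rfl⟩
    simp [hfv, hS v hv, hS w hw]
  have hker : Module.finrank ℝ (LinearMap.ker f) = m := by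
    have h1 := f.finrank_range_add_finrank_ker
    have h2 : LinearMap.range f = ⊤ := by
      rw [LinearMap.range_eq_top]
      exact fun r => ⟨Pi.single 0 r, by simp [hfv]⟩
    rw [h2, finrank_top, Module.finrank_self, Module.finrank_fin_fun] at h1
    omega
  -- Equal dimension makes every vector of coordinate sum zero a direction of the affine span.
  have heq := Submodule.eq_of_le_of_finrank_eq hle (hdim.trans hker.symm)
  obtain ⟨⟨y, hy⟩, hint, rfl⟩ := mem_intrinsicInterior.1 hP
  obtain ⟨ε, hε, hball⟩ := Metric.mem_nhds_iff.1 (mem_interior_iff_mem_nhds.1 hint)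
  refine ⟨ε / 2, by positivity, fun w hw hwn => ?_⟩
  have hwd : w ∈ (affineSpan ℝ S).direction := by
    rw [heq, LinearMap.mem_ker, hfv, hw]
  have hmem : y + w ∈ affineSpan ℝ S := by
    have h := AffineSubspace.vadd_mem_of_mem_direction hwd hy
    rwa [vadd_eq_add, add_comm w y] at h
  refine hball (show (⟨y + w, hmem⟩ : affineSpan ℝ S) ∈ Metric.ball _ ε from ?_)
  rw [Metric.mem_ball, Subtype.dist_eq, dist_eq_norm]
  simp only [add_sub_cancel_left]
  linarith

/-- In a hyperplane `∑ w_k = 0` there are small vectors whose pairing with `ξ` is a positive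
multiple of `∑ |ξ_k|`. -/
theorem exists_sum_eq_zero_dotProduct_eq {m : ℕ} {ξ : Fin (m + 1) → ℝ}
    (hξ : ξ (Fin.last m) = 0) {δ : ℝ} (hδ : 0 ≤ δ) :
    ∃ w : Fin (m + 1) → ℝ, ∑ k, w k = 0 ∧ ‖w‖ ≤ δ ∧
      w ⬝ᵥ ξ = δ / (m + 1) * ∑ i : Fin m, |ξ i.castSucc| := by
  set σ : Fin m → ℝ := fun i => if 0 ≤ ξ i.castSucc then 1 else -1 with hσ
  have hσ1 : ∀ i, |σ i| = 1 := fun i => by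
    simp only [hσ]
    split_ifs <;> simp
  have hσ2 : ∀ i, σ i * ξ i.castSucc = |ξ i.castSucc| := fun i => by
    simp only [hσ]
    split_ifs with h
    · rw [abs_of_nonneg h, one_mul]
    · rw [abs_of_neg (not_le.1 h), neg_one_mul]
  -- The last coordinate of `w` balances the others at no cost, since `ξ` vanishes there. It can be
  -- as large as `r * m`, which is still at most `δ`.
  set r : ℝ := δ / (m + 1) with hr
  have hr0 : 0 ≤ r := by positivity
  have hrδ : r * (m + 1) = δ := by rw [hr]; field_simp
  refine ⟨Fin.snoc (fun i => r * σ i) (-∑ i, r * σ i), ?_, ?_, ?_⟩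
  · simp [Fin.sum_univ_castSucc]
  · rw [pi_norm_le_iff_of_nonneg hδ]
    intro k
    have hm : (0 : ℝ) ≤ r * m := by positivity
    refine Fin.lastCases ?_ (fun i => ?_) k
    · rw [Fin.snoc_last, norm_neg]
      refine (norm_sum_le _ _).trans ?_
      simp only [norm_mul, Real.norm_eq_abs, hσ1, abs_of_nonneg hr0, mul_one, Finset.sum_const,
        Finset.card_univ, Fintype.card_fin, nsmul_eq_mul]
      linarith
    · rw [Fin.snoc_castSucc, norm_mul, Real.norm_eq_abs, Real.norm_eq_abs, hσ1, abs_of_nonneg hr0]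
      linarith
  · simp only [dotProduct, Fin.sum_univ_castSucc, Fin.snoc_castSucc, Fin.snoc_last, hξ, mul_zero,
      add_zero, mul_assoc, hσ2, Finset.mul_sum]

/-! ### Exponential decay of the integrand -/

section Decay

variable {m : ℕ} {ι κ : Type*} [Fintype ι] [Fintype κ]

theorem exp_sum_smul_dotProduct {n : ℕ} (r : ι → ℝ) (v : ι → Fin n → ℝ) (ξ : Fin n → ℝ) :
    Real.exp ((∑ i, r i • v i) ⬝ᵥ ξ) = ∏ i, Real.exp (v i ⬝ᵥ ξ) ^ r i := by
  rw [sum_dotProduct, Real.exp_sum]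
  refine Finset.prod_congr rfl fun i _ => ?_
  rw [smul_dotProduct, smul_eq_mul, mul_comm, Real.exp_mul]

theorem exists_prod_norm_branchPow_le {n : ℕ} {a : ι → MvPolynomial (Fin n) ℂ} {da : ι → ℕ}
    {ν : ι → ℂ} (ha0 : ∀ i, a i ≠ 0) (hν : ∀ i, 0 ≤ (ν i).re) {La : ι → (Fin n → ℝ) → ℂ}
    (hLa : ∀ i, IsLogBranch (a i) (da i) (La i)) :
    ∃ C : ℝ, 0 < C ∧ ∀ ξ : Fin n → ℝ, ∃ l : ∀ i, (a i).support,
      ‖∏ i, branchPow (a i) (La i) (ν i) (expPoint ξ)‖ ≤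
        C * Real.exp ((∑ i, (ν i).re • expVec (l i).1) ⬝ᵥ ξ) := by
  choose C hC hbd using fun i => (hLa i).exists_norm_branchPow_le (ν i)
  choose K hK l hl hle using fun i => exists_norm_evalReal_le (ha0 i)
  refine ⟨∏ i, C i * K i ^ (ν i).re,
    Finset.prod_pos fun i _ => mul_pos (hC i) (Real.rpow_pos_of_pos (hK i) _),
    fun ξ => ⟨fun i => ⟨l i ξ, hl i ξ⟩, ?_⟩⟩
  rw [norm_prod, exp_sum_smul_dotProduct, ← Finset.prod_mul_distrib]
  refine Finset.prod_le_prod (fun _ _ => norm_nonneg _) fun i _ => ?_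
  refine (hbd i _ (expPoint_mem_orthant ξ)).trans ?_
  rw [mul_assoc, ← Real.mul_rpow (hK i).le (Real.exp_pos _).le]
  exact mul_le_mul_of_nonneg_left
    (Real.rpow_le_rpow (norm_nonneg _) (hle i ξ) (hν i)) (hC i).le

/-- The constant serves all points of the Minkowski sum at once, so the point may later be chosen
depending on `ξ`. -/
theorem exists_le_prod_norm_branchPow {b : κ → MvPolynomial (Fin (m + 1)) ℂ} {db : κ → ℕ}
    {ρ : κ → ℂ} (hρ : ∀ j, 0 ≤ (ρ j).re) {Lb : κ → (Fin (m + 1) → ℝ) → ℂ}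
    (hLb : ∀ j, IsLogBranch (b j) (db j) (Lb j))
    (hnv : ∀ j, CompletelyNonvanishingOn (b j) (posProj (m + 1))) :
    ∃ c : ℝ, 0 < c ∧ ∀ ξ : Fin (m + 1) → ℝ,
      ∀ v ∈ ∑ j, (ρ j).re • newtonPolytope (b j),
        c * Real.exp (v ⬝ᵥ ξ) ≤ ‖∏ j, branchPow (b j) (Lb j) (ρ j) (expPoint ξ)‖ := by
  choose c hc hbd using fun j => (hLb j).exists_le_norm_branchPow (ρ j)
  choose K hK hle using fun j => (hnv j).exists_le_norm_evalReal
  refine ⟨∏ j, c j * K j ^ (ρ j).re,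
    Finset.prod_pos fun j _ => mul_pos (hc j) (Real.rpow_pos_of_pos (hK j) _), fun ξ v hv => ?_⟩
  obtain ⟨g, hg, rfl⟩ := (Set.mem_fintype_sum _ _).1 hv
  choose u hu hgu using fun j => Set.mem_smul_set.1 (hg j)
  rw [← Finset.sum_congr rfl fun j _ => hgu j, norm_prod, exp_sum_smul_dotProduct,
    ← Finset.prod_mul_distrib]
  refine Finset.prod_le_prod (fun j _ => ?_) fun j _ => ?_
  · exact mul_nonneg (mul_pos (hc j) (Real.rpow_pos_of_pos (hK j) _)).le
      (Real.rpow_nonneg (Real.exp_pos _).le _)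
  · refine le_trans ?_ (hbd j _ (expPoint_mem_orthant ξ) ((hnv j).evalReal_ne_zero ξ))
    rw [mul_assoc, ← Real.mul_rpow (hK j).le (Real.exp_pos _).le]
    exact mul_le_mul_of_nonneg_left (Real.rpow_le_rpow
      (mul_pos (hK j) (Real.exp_pos _)).le (hle j ξ _ (hu j)) (hρ j)) (hc j).le

/-- In logarithmic coordinates the integrand decays exponentially. -/
theorem exists_norm_quotientFun_le {a : ι → MvPolynomial (Fin (m + 1)) ℂ}
    {b : κ → MvPolynomial (Fin (m + 1)) ℂ} {da : ι → ℕ} {db : κ → ℕ} {ν : ι → ℂ} {ρ : κ → ℂ}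
    (ha0 : ∀ i, a i ≠ 0) (hb : ∀ j, (b j).IsHomogeneous (db j))
    (hν : ∀ i, 0 ≤ (ν i).re) (hρ : ∀ j, 0 ≤ (ρ j).re)
    {La : ι → (Fin (m + 1) → ℝ) → ℂ} {Lb : κ → (Fin (m + 1) → ℝ) → ℂ}
    (hLa : ∀ i, IsLogBranch (a i) (da i) (La i)) (hLb : ∀ j, IsLogBranch (b j) (db j) (Lb j))
    (hdim : Module.finrank ℝ
      (affineSpan ℝ (∑ j, (ρ j).re • newtonPolytope (b j))).direction = m)
    (hsub : ∑ i, (ν i).re • newtonPolytope (a i) ⊆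
      intrinsicInterior ℝ (∑ j, (ρ j).re • newtonPolytope (b j)))
    (hnv : ∀ j, CompletelyNonvanishingOn (b j) (posProj (m + 1))) :
    ∃ C δ : ℝ, 0 < δ ∧ ∀ ξ : Fin (m + 1) → ℝ, ξ (Fin.last m) = 0 →
      ‖quotientFun a La ν b Lb ρ (expPoint ξ)‖ ≤
        C * Real.exp (-(δ * ∑ i : Fin m, |ξ i.castSucc|)) := by
  obtain ⟨C, hC, hup⟩ := exists_prod_norm_branchPow_le ha0 hν hLa
  obtain ⟨c, hc, hlow⟩ := exists_le_prod_norm_branchPow hρ hLb hnv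
  have hB : ∀ v ∈ ∑ j, (ρ j).re • newtonPolytope (b j), ∑ k, v k = ∑ j, (ρ j).re * db j := by
    intro v hv
    obtain ⟨g, hg, rfl⟩ := (Set.mem_fintype_sum _ _).1 hv
    choose u hu hgu using fun j => Set.mem_smul_set.1 (hg j)
    simp only [Finset.sum_apply]
    rw [Finset.sum_comm]
    refine Finset.sum_congr rfl fun j _ => ?_
    rw [← hgu j, ← sum_eq_of_mem_newtonPolytope (hb j) (hu j), Finset.mul_sum]
    rfl
  -- Only finitely many points of the numerator's Minkowski sum occur, so the least of their radii
  -- is positive.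
  choose ε hε hball using fun l : ∀ i, (a i).support =>
    exists_add_mem_of_mem_intrinsicInterior hB hdim (hsub ((Set.mem_fintype_sum _ _).2
      ⟨fun i => (ν i).re • expVec (l i).1, fun i =>
        Set.smul_mem_smul_set (expVec_mem_newtonPolytope (l i).2), rfl⟩))
  have : Nonempty (∀ i, (a i).support) :=
    ⟨fun i => ⟨_, (MvPolynomial.support_nonempty.2 (ha0 i)).choose_spec⟩⟩
  obtain ⟨l₀, hl₀⟩ := Finite.exists_min ε
  refine ⟨C / c, ε l₀ / (m + 1), div_pos (hε l₀) (by positivity), fun ξ hξ => ?_⟩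
  obtain ⟨l, hl⟩ := hup ξ
  obtain ⟨w, hw0, hwn, hwξ⟩ := exists_sum_eq_zero_dotProduct_eq hξ (hε l₀).le
  -- The denominator is tested at the numerator's point shifted by `w`; in the quotient only `exp
  -- (-⟨w, ξ⟩)` remains.
  have h1 := hlow ξ _ (hball l w hw0 (hwn.trans (hl₀ l)))
  rw [add_dotProduct, hwξ, Real.exp_add] at h1
  have hE := Real.exp_pos ((∑ i, (ν i).re • expVec (l i).1) ⬝ᵥ ξ)
  have hF := Real.exp_pos (ε l₀ / (m + 1) * ∑ i : Fin m, |ξ i.castSucc|)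
  rw [quotientFun, norm_div]
  refine (div_le_div₀ (by positivity) hl (by positivity) h1).trans_eq ?_
  rw [Real.exp_neg]
  field_simp

end Decay

/-! ### Integrability -/

/-- This is `exp (-δ |s|) ds` under `u = exp s`: the integrand is `u ^ (δ - 1)` on `(0, 1]` and `u ^
(-δ - 1)` beyond. -/
theorem integrableOn_inv_mul_exp_neg_abs_log {δ : ℝ} (hδ : 0 < δ) :
    IntegrableOn (fun u : ℝ => u⁻¹ * Real.exp (-(δ * |Real.log u|))) (Set.Ioi 0) := by
  rw [← Set.Ioc_union_Ioi_eq_Ioi zero_le_one, integrableOn_union]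
  constructor
  · have h1 := (intervalIntegrable_iff_integrableOn_Ioc_of_le zero_le_one).1
      (intervalIntegral.intervalIntegrable_rpow' (a := 0) (b := 1) (r := δ - 1) (by linarith))
    refine h1.congr_fun (fun u hu => ?_) measurableSet_Ioc
    rw [abs_of_nonpos (Real.log_nonpos hu.1.le hu.2)]
    change u ^ (δ - 1) = _
    rw [Real.rpow_sub hu.1, Real.rpow_one, Real.rpow_def_of_pos hu.1, div_eq_inv_mul]
    congr 2
    ring
  · refine (integrableOn_Ioi_rpow_of_lt (a := -δ - 1) (by linarith) one_pos).congr_fun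
      (fun u hu => ?_) measurableSet_Ioi
    have hu0 : (0 : ℝ) < u := one_pos.trans hu
    rw [abs_of_nonneg (Real.log_nonneg (le_of_lt hu))]
    change u ^ (-δ - 1) = _
    rw [Real.rpow_sub hu0, Real.rpow_one, Real.rpow_def_of_pos hu0, div_eq_inv_mul]
    congr 2
    ring

theorem orthant_eq_pi (n : ℕ) : orthant n = Set.univ.pi fun _ => Set.Ioi 0 := by
  ext x
  simp [orthant]

theorem integrableOn_orthant_prod {m : ℕ} {δ : ℝ} (hδ : 0 < δ) :
    IntegrableOn (fun u : Fin m → ℝ => ∏ i, (u i)⁻¹ * Real.exp (-(δ * |Real.log (u i)|)))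
      (orthant m) := by
  rw [IntegrableOn, orthant_eq_pi, volume_pi, Measure.restrict_pi_pi]
  exact Integrable.fintype_prod fun _ => integrableOn_inv_mul_exp_neg_abs_log hδ

theorem affineLift_mem_orthant {m : ℕ} {u : Fin m → ℝ} (hu : u ∈ orthant m) :
    affineLift u ∈ orthant (m + 1) := fun k => by
  refine Fin.lastCases ?_ (fun i => ?_) k
  · simp [affineLift]
  · simpa [affineLift] using hu i

theorem measurable_affineLift (m : ℕ) : Measurable (affineLift (m := m)) := by
  refine measurable_pi_lambda _ fun k => ?_
  refine Fin.lastCases ?_ (fun i => ?_) k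
  · simp [affineLift]
  · simpa [affineLift] using measurable_pi_apply i

/-- Stated on the subtype because a branch is measurable only on the orthant. -/
theorem measurable_branchPow {n : ℕ} {p : MvPolynomial (Fin n) ℂ} {d : ℕ}
    {L : (Fin n → ℝ) → ℂ} (hL : IsLogBranch p d L) (s : ℂ) :
    Measurable fun x : orthant n => branchPow p L s x := by
  have hp : Continuous fun x : Fin n → ℝ => evalReal p x :=
    (MvPolynomial.continuous_eval p).comp (by fun_prop)
  unfold branchPow
  refine Measurable.ite ?_ measurable_const ?_
  · exact (hp.measurable.comp measurable_subtype_coe) (measurableSet_singleton 0)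
  · exact Complex.measurable_exp.comp (measurable_const.mul hL.measurable)

theorem measurable_quotientFun {n : ℕ} {ι κ : Type*} [Fintype ι] [Fintype κ]
    {a : ι → MvPolynomial (Fin n) ℂ} {b : κ → MvPolynomial (Fin n) ℂ} {da : ι → ℕ} {db : κ → ℕ}
    (ν : ι → ℂ) (ρ : κ → ℂ) {La : ι → (Fin n → ℝ) → ℂ} {Lb : κ → (Fin n → ℝ) → ℂ}
    (hLa : ∀ i, IsLogBranch (a i) (da i) (La i)) (hLb : ∀ j, IsLogBranch (b j) (db j) (Lb j)) :
    Measurable fun x : orthant n => quotientFun a La ν b Lb ρ x :=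
  (Finset.measurable_prod _ fun i _ => measurable_branchPow (hLa i) (ν i)).div
    (Finset.measurable_prod _ fun j _ => measurable_branchPow (hLb j) (ρ j))

/-- A function on the positive simplex that decays exponentially in logarithmic coordinates is
integrable. -/
theorem integrableOn_descend_of_norm_le {m : ℕ} {g : (Fin (m + 1) → ℝ) → ℂ}
    (hg : Measurable fun x : orthant (m + 1) => g x) {C δ : ℝ} (hδ : 0 < δ)
    (hle : ∀ ξ : Fin (m + 1) → ℝ, ξ (Fin.last m) = 0 →
      ‖g (expPoint ξ)‖ ≤ C * Real.exp (-(δ * ∑ i : Fin m, |ξ i.castSucc|))) :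
    IntegrableOn (descend g) (posProj (m + 1)) (canonicalMeasure m) := by
  have hO : MeasurableSet (orthant m) := by
    rw [orthant_eq_pi]
    exact MeasurableSet.univ_pi fun _ => measurableSet_Ioi
  rw [integrableOn_descend_iff]
  refine Integrable.mono' ((integrableOn_orthant_prod hδ).const_mul C) ?_ ?_
  · refine (aemeasurable_restrict_of_measurable_subtype hO ?_).aestronglyMeasurable
    have h1 : Measurable fun u : orthant m => ∏ i, (u.1 i)⁻¹ :=
      Finset.measurable_prod _ fun i _ =>
        ((measurable_pi_apply i).comp measurable_subtype_coe).inv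
    have h2 : Measurable fun u : orthant m => g (affineLift u.1) :=
      hg.comp (((measurable_affineLift m).comp measurable_subtype_coe).subtype_mk
        (h := fun u => affineLift_mem_orthant u.2))
    exact h1.smul h2
  · filter_upwards [ae_restrict_mem hO] with u hu
    have hexp : expPoint (fun k => Real.log (affineLift u k)) = affineLift u :=
      funext fun k => Real.exp_log (affineLift_mem_orthant hu k)
    -- The chart sets the last coordinate to `1`, whose logarithm is `0`.
    have h1 := hle (fun k => Real.log (affineLift u k)) (by simp [affineLift])
    rw [hexp] at h1
    have h0 : 0 ≤ ∏ i, (u i)⁻¹ := Finset.prod_nonneg fun i _ => (inv_pos.2 (hu i)).le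
    rw [norm_smul, Real.norm_of_nonneg h0, Finset.prod_mul_distrib, ← Real.exp_sum]
    refine (mul_le_mul_of_nonneg_left h1 h0).trans_eq ?_
    simp only [affineLift, Fin.snoc_castSucc, Finset.mul_sum, Finset.sum_neg_distrib]
    ring

end ProjIntegral

theorem theorem2p1 (m : ℕ) {ι κ : Type*} [Fintype ι] [Fintype κ]
    (a : ι → MvPolynomial (Fin (m + 1)) ℂ) (b : κ → MvPolynomial (Fin (m + 1)) ℂ)
    (da : ι → ℕ) (db : κ → ℕ) (ν : ι → ℂ) (ρ : κ → ℂ)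
    (ha0 : ∀ i, a i ≠ 0)
    (ha : ∀ i, (a i).IsHomogeneous (da i)) (hb : ∀ j, (b j).IsHomogeneous (db j))
    (hdeg : ∑ i, ν i * (da i : ℂ) = ∑ j, ρ j * (db j : ℂ))
    (hν : ∀ i, 0 ≤ (ν i).re) (hρ : ∀ j, 0 ≤ (ρ j).re)
    (La : ι → (Fin (m + 1) → ℝ) → ℂ) (Lb : κ → (Fin (m + 1) → ℝ) → ℂ)
    (hLa : ∀ i, ProjIntegral.IsLogBranch (a i) (da i) (La i))
    (hLb : ∀ j, ProjIntegral.IsLogBranch (b j) (db j) (Lb j))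
    (A B : Set (Fin (m + 1) → ℝ))
    (hA : A = ∑ i, (ν i).re • ProjIntegral.newtonPolytope (a i))
    (hB : B = ∑ j, (ρ j).re • ProjIntegral.newtonPolytope (b j))
    (hR1 : Module.finrank ℝ (affineSpan ℝ B).direction = m)
    (hR2 : A ⊆ intrinsicInterior ℝ B)
    (hR3 : ∀ j, ProjIntegral.CompletelyNonvanishingOn (b j) (ProjIntegral.posProj (m + 1))) :
    MeasureTheory.IntegrableOn
      (ProjIntegral.descend (ProjIntegral.quotientFun a La ν b Lb ρ))
      (ProjIntegral.posProj (m + 1)) (ProjIntegral.canonicalMeasure m) := by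
  subst hA hB
  obtain ⟨C, δ, hδ, hle⟩ := ProjIntegral.exists_norm_quotientFun_le ha0 hb hν hρ hLa hLb hR1 hR2 hR3
  exact ProjIntegral.integrableOn_descend_of_norm_le
    (ProjIntegral.measurable_quotientFun ν ρ hLa hLb) hδ hle
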